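/- Let $r_n>0$, $d_n\ge 0$ for all $n\ge 1$, $a_1=0$ and $a_n>0$ for $n\ge 2$, and put $\theta_n=r_n+a_n+d_n$. Let $X$ be the space of real sequences $f=(f_n)_{n\ge1}$ with $\|f\|=\sum_{n\ge1} n|f_n|<\infty$. Define $[A_0f]_n=-\theta_nf_n$ on $D(A_0)=\{f\in X:(\theta_nf_n)_n\in X\}$ and $[A_1f]_n=r_{n+1}f_{n+1}$ on $D(A_1)=\{f\in X:(r_nf_n)_n\in X\}\supset D(A_0)$. A substochastic $C_0$-semigroup on $X$ is a strongly continuous semigroup of contractions that map nonnegative sequences to nonnegative sequences. Then the operator $A_0+A_1$ with domain $D(A_0)$ is closable. Let $K=\overline{A_0+A_1}$ be its closure in $X$. Whenever $G$ is the generator of a substochastic $C_0$-semigroup on $X$ that is the smallest one (entrywise, on nonnegative sequences) among all substochastic $C_0$-semigroups generated by extensions of $A_0+A_1$, then $G=K$. Moreover, if $f\in D(K)$ and $f_n\ge0$ for all $n$, then $$\sum_{n=1}^\infty n a_nf_n<\infty,\qquad \sum_{n=1}^\infty n d_nf_n<\infty,\qquad \sum_{n=1}^\infty r_nf_n<\infty,$$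 and $$\lim_{n\to\infty} n r_nf_n=0.$$ -/

import Mathlib

open Filter Topology
open scoped NNReal

namespace DecayFragmentation

/-- The real sequences `(f_n)_{n ≥ 1}` with `∑ n |f_n| < ∞`, as a linear subspace of all sequences. -/
def massSubmodule : Submodule ℝ (ℕ+ → ℝ) where
  carrier := {f | Summable fun n : ℕ+ => (n : ℝ) * |f n|}
  zero_mem' := by simp [summable_zero]
  add_mem' := by
    intro f g hf hg
    refine Summable.of_nonneg_of_le (fun n => by positivity) (fun n => ?_) (hf.add hg)
    rw [← mul_add]
    exact mul_le_mul_of_nonneg_left (abs_add_le _ _) (by positivity)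
  smul_mem' := by
    intro c f hf
    refine (Summable.mul_left |c| hf).congr fun n => ?_
    simp only [Pi.smul_apply, smul_eq_mul, abs_mul]
    ring

/-- The space `X` of sequences of finite total mass. It is a type of its own so that it carries
the topology of the mass norm and not that of pointwise convergence. -/
def X : Type := massSubmodule

namespace X

instance : AddCommGroup X := inferInstanceAs (AddCommGroup massSubmodule)

instance : Module ℝ X := inferInstanceAs (Module ℝ massSubmodule)

instance : CoeFun X (fun _ => ℕ+ → ℝ) := ⟨fun f => f.1⟩

theorem summable (f : X) : Summable fun n : ℕ+ => (n : ℝ) * |f n| := f.2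

theorem add_apply (f g : X) (n : ℕ+) : (f + g) n = f n + g n := rfl

theorem smul_apply (c : ℝ) (f : X) (n : ℕ+) : (c • f) n = c * f n := rfl

/-- The mass norm `‖f‖ = ∑ n |f_n|`. -/
noncomputable def massNorm : AddGroupNorm X where
  toFun f := ∑' n : ℕ+, (n : ℝ) * |f n|
  map_zero' := by
    have h (n : ℕ+) : (0 : X) n = 0 := rfl
    simp [h]
  add_le' f g := by
    rw [← f.summable.tsum_add g.summable]
    refine (f + g).summable.tsum_le_tsum (fun n => ?_) (f.summable.add g.summable)
    rw [← mul_add]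
    exact mul_le_mul_of_nonneg_left (abs_add_le _ _) (by positivity)
  neg' f := by
    have h (n : ℕ+) : (-f) n = -f n := rfl
    simp [h]
  eq_zero_of_map_eq_zero' f hf := by
    have h0 := (hasSum_zero_iff_of_nonneg (fun n : ℕ+ => by positivity)).1
      (hf ▸ f.summable.hasSum)
    refine Subtype.ext (funext fun n => ?_)
    have h1 : (n : ℝ) * |f n| = 0 := congrFun h0 n
    have h2 : (n : ℝ) ≠ 0 := by exact_mod_cast n.ne_zero
    exact abs_eq_zero.1 ((mul_eq_zero.1 h1).resolve_left h2)

noncomputable instance : NormedAddCommGroup X := massNorm.toNormedAddCommGroup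

theorem norm_def (f : X) : ‖f‖ = ∑' n : ℕ+, (n : ℝ) * |f n| := rfl

noncomputable instance : NormedSpace ℝ X where
  norm_smul_le c f := by
    rw [norm_def, norm_def, Real.norm_eq_abs, ← tsum_mul_left]
    refine le_of_eq (tsum_congr fun n => ?_)
    rw [smul_apply, abs_mul]
    ring

/-- Membership in the positive cone: all entries are nonnegative. -/
def Nonneg (f : X) : Prop := ∀ n, 0 ≤ f n

end X

/-- The maximal multiplication domain `{f ∈ X : (w_n f_n)_n ∈ X}` of a weight `w`. -/
def multDomain (w : ℕ+ → ℝ) : Submodule ℝ X where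
  carrier := {f | (fun n => w n * f n) ∈ massSubmodule}
  zero_mem' := by
    have h : (fun n => w n * (0 : X) n) = 0 := funext fun n => mul_zero (w n)
    simpa only [Set.mem_ofPred_eq, h] using massSubmodule.zero_mem
  add_mem' := by
    intro f g hf hg
    have h : (fun n => w n * (f + g) n) = (fun n => w n * f n) + fun n => w n * g n :=
      funext fun n => mul_add (w n) (f n) (g n)
    simpa only [Set.mem_ofPred_eq, h] using massSubmodule.add_mem hf hg
  smul_mem' := by
    intro c f hf
    have h : (fun n => w n * (c • f) n) = c • fun n => w n * f n :=
      funext fun n => mul_left_comm (w n) c (f n)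
    simpa only [Set.mem_ofPred_eq, h] using massSubmodule.smul_mem c hf

theorem neg_mult_mem {w : ℕ+ → ℝ} {f : X} (hf : f ∈ multDomain w) :
    (fun n => -(w n * f n)) ∈ massSubmodule :=
  massSubmodule.neg_mem hf

theorem shift_mult_mem {w : ℕ+ → ℝ} {f : X} (hf : f ∈ multDomain w) :
    (fun n => w (n + 1) * f (n + 1)) ∈ massSubmodule := by
  have h1 : Summable fun n : ℕ+ => (n : ℝ) * |w n * f n| := hf
  have h2 : Summable fun n : ℕ+ => ((n + 1 : ℕ+) : ℝ) * |w (n + 1) * f (n + 1)| :=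
    h1.comp_injective (i := fun n : ℕ+ => n + 1) (add_left_injective 1)
  refine Summable.of_nonneg_of_le (fun n => by positivity) (fun n => ?_) h2
  refine mul_le_mul_of_nonneg_right ?_ (abs_nonneg _)
  push_cast
  linarith

/-- The total loss rate `θ_n = r_n + a_n + d_n`. -/
def theta (r d a : ℕ+ → ℝ) (n : ℕ+) : ℝ := r n + a n + d n

/-- The diagonal operator `[A₀ f]_n = -θ_n f_n` with `D(A₀) = {f ∈ X : θ f ∈ X}`. -/
def A₀ (r d a : ℕ+ → ℝ) : X →ₗ.[ℝ] X where
  domain := multDomain (theta r d a)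
  toFun :=
    { toFun := fun f => ⟨fun n => -(theta r d a n * f.1 n), neg_mult_mem f.2⟩
      map_add' := fun f g => Subtype.ext <| funext fun n => by
        change -(theta r d a n * (f.1 n + g.1 n)) =
          -(theta r d a n * f.1 n) + -(theta r d a n * g.1 n)
        ring
      map_smul' := fun c f => Subtype.ext <| funext fun n => by
        change -(theta r d a n * (c * f.1 n)) = c * -(theta r d a n * f.1 n)
        ring }

/-- The off-diagonal operator `[A₁ f]_n = r_{n+1} f_{n+1}` with `D(A₁) = {f ∈ X : r f ∈ X}`. -/
def A₁ (r : ℕ+ → ℝ) : X →ₗ.[ℝ] X where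
  domain := multDomain r
  toFun :=
    { toFun := fun f => ⟨fun n => r (n + 1) * f.1 (n + 1), shift_mult_mem f.2⟩
      map_add' := fun f g => Subtype.ext <| funext fun n =>
        mul_add (r (n + 1)) (f.1 (n + 1)) (g.1 (n + 1))
      map_smul' := fun c f => Subtype.ext <| funext fun n =>
        mul_left_comm (r (n + 1)) c (f.1 (n + 1)) }

/-- The sum `A₀ + A₁` on `D(A₀) ∩ D(A₁)`, which is `D(A₀)` for nonnegative coefficients. -/
def decaySum (r d a : ℕ+ → ℝ) : X →ₗ.[ℝ] X := A₀ r d a + A₁ r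

theorem decaySum_domain {r d a : ℕ+ → ℝ} (hr : ∀ n, 0 < r n) (hd : ∀ n, 0 ≤ d n)
    (ha : ∀ n, 0 ≤ a n) : (decaySum r d a).domain = (A₀ r d a).domain := by
  refine inf_eq_left.2 fun f hf => ?_
  have h1 : Summable fun n : ℕ+ => (n : ℝ) * |theta r d a n * f n| := hf
  refine Summable.of_nonneg_of_le (fun n => by positivity) (fun n => ?_) h1
  refine mul_le_mul_of_nonneg_left ?_ (by positivity)
  rw [abs_mul, abs_mul]
  refine mul_le_mul_of_nonneg_right ?_ (abs_nonneg _)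
  refine abs_le_abs_of_nonneg (hr n).le ?_
  unfold theta
  linarith [hd n, ha n]

/-- The operator `K`: the closure of `A₀ + A₁` in `X`. -/
noncomputable def K (r d a : ℕ+ → ℝ) : X →ₗ.[ℝ] X := (decaySum r d a).closure

/-- A substochastic `C₀`-semigroup on `X`: a strongly continuous semigroup of positive
contractions. -/
structure IsSubstochasticSemigroup (S : ℝ≥0 → X →L[ℝ] X) : Prop where
  zero : S 0 = ContinuousLinearMap.id ℝ X
  add : ∀ s t, S (s + t) = (S s).comp (S t)
  strongly_continuous : ∀ f, Tendsto (fun t => S t f) (𝓝 0) (𝓝 f)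
  positive : ∀ t f, f.Nonneg → (S t f).Nonneg
  contraction : ∀ t f, ‖S t f‖ ≤ ‖f‖

/-- `G` is the (infinitesimal) generator of `S`: `f ∈ D(G)` and `G f = g` exactly when
`(S(t) f - f) / t → g` as `t → 0⁺`. -/
def IsGenerator (S : ℝ≥0 → X →L[ℝ] X) (G : X →ₗ.[ℝ] X) : Prop :=
  ∀ f g : X, (f, g) ∈ G.graph ↔
    Tendsto (fun t : ℝ≥0 => (t : ℝ)⁻¹ • (S t f - f)) (𝓝[>] 0) (𝓝 g)

/-- `S` is a substochastic `C₀`-semigroup on `X` whose generator `G` is an extension of `T`. -/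
def GeneratesExtension (T : X →ₗ.[ℝ] X) (S : ℝ≥0 → X →L[ℝ] X) (G : X →ₗ.[ℝ] X) : Prop :=
  IsSubstochasticSemigroup S ∧ IsGenerator S G ∧ T ≤ G

/-- `G` is the generator of the smallest substochastic `C₀`-semigroup that is generated by an
extension of `T`. -/
def IsSmallestGenerator (T G : X →ₗ.[ℝ] X) : Prop :=
  ∃ S, GeneratesExtension T S G ∧
    ∀ S' G', GeneratesExtension T S' G' →
      ∀ t f, f.Nonneg → ∀ n, (S t f) n ≤ (S' t f) n

end DecayFragmentation

/-! Write `T` for `decaySum r d a`. Since `n θ_n - (n - 1) r_n = n a_n + n d_n + r_n`, weighting `u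
- T u` by `n` and summing gives `‖u‖ + ∑ w_n |u_n| ≤ ‖u - T u‖` with `w = lossWeight r d a`
(`norm_add_sum_le_of_mem_graph`). Its partial sums are closed conditions on the graph, so the
estimate on them survives in `K` and yields the three series. Telescoping bounds `n r_n |u_n|` by
the graph norm uniformly in `n` (`mul_mul_abs_le_of_mem_graph`), so the limit `0`, clear on `D(T)`,
extends to `D(K)`.

A generator of a contraction semigroup is closed and dissipative, and `1 - T` is triangular on unit
sequences, hence has dense range. A closed dissipative extension of such a `T` must be `K`. -/

namespace DecayFragmentation

/-! ### Coordinates and unit sequences in `X`. -/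

namespace X

theorem sub_apply (f g : X) (n : ℕ+) : (f - g) n = f n - g n := rfl

theorem ext {f g : X} (h : ∀ n, f n = g n) : f = g := Subtype.ext (funext h)

theorem mul_abs_apply_le_norm (f : X) (n : ℕ+) : (n : ℝ) * |f n| ≤ ‖f‖ :=
  f.summable.le_tsum n fun _ _ => by positivity

theorem abs_apply_le_norm (f : X) (n : ℕ+) : |f n| ≤ ‖f‖ := by
  refine le_trans ?_ (f.mul_abs_apply_le_norm n)
  have hn : (1 : ℝ) ≤ n := by exact_mod_cast one_le (a := n)
  exact le_mul_of_one_le_left (abs_nonneg _) hn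

theorem continuous_apply (n : ℕ+) : Continuous fun f : X => f n := by
  refine LipschitzWith.continuous (K := 1) (LipschitzWith.of_dist_le_mul fun f g => ?_)
  rw [Real.dist_eq, dist_eq_norm, NNReal.coe_one, one_mul, ← sub_apply]
  exact abs_apply_le_norm _ n

/-- The unit sequence at `n`. -/
noncomputable def single (n : ℕ+) : X :=
  ⟨Pi.single n 1, summable_of_ne_finset_zero (s := {n}) fun m hm => by
    simp [Pi.single_eq_of_ne (show m ≠ n by simpa using hm)]⟩

theorem single_same (n : ℕ+) : single n n = 1 := Pi.single_eq_same (M := fun _ => ℝ) n 1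

theorem single_of_ne {m n : ℕ+} (h : m ≠ n) : single n m = 0 :=
  Pi.single_eq_of_ne (M := fun _ => ℝ) h 1

/-- Evaluation of a sequence at `n`, as a linear map. -/
def coord (n : ℕ+) : X →ₗ[ℝ] ℝ where
  toFun f := f n
  map_add' _ _ := rfl
  map_smul' _ _ := rfl

theorem hasSum_single (f : X) : HasSum (fun n => f n • single n) f := by
  classical
  have hz := tendsto_tsum_compl_atTop_zero fun n : ℕ+ => (n : ℝ) * |f n|
  refine tendsto_iff_norm_sub_tendsto_zero.2 (hz.congr fun s => ?_)
  have hs (m : ℕ+) : (∑ n ∈ s, f n • single n : X) m = if m ∈ s then f m else 0 := by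
    change coord m _ = _
    rw [map_sum]
    have (n : ℕ+) : coord m (f n • single n) = if m = n then f n else 0 := by
      change f n * single n m = _
      split_ifs with h
      · subst h; rw [single_same, mul_one]
      · rw [single_of_ne h, mul_zero]
    simp only [this, Finset.sum_ite_eq]
  -- The error of the partial sum over `s` is exactly the mass carried outside `s`.
  rw [norm_def, ← tsum_subtype_eq_of_support_subset (s := {m | m ∉ s})]
  · refine tsum_congr fun m => ?_
    have hm : (m : ℕ+) ∉ s := m.2
    rw [sub_apply, hs, if_neg hm, zero_sub, abs_neg]
  · intro m hm hms
    refine hm ?_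
    simp only [sub_apply, hs, if_pos hms, sub_self, abs_zero, mul_zero]

theorem topologicalClosure_eq_top_of_single_mem {p : Submodule ℝ X} (hp : ∀ n, single n ∈ p) :
    p.topologicalClosure = ⊤ := by
  refine eq_top_iff.2 fun f _ => mem_closure_of_tendsto f.hasSum_single ?_
  exact Eventually.of_forall fun s => p.sum_mem fun n _ => p.smul_mem _ (hp n)

end X

/-! ### Generators of substochastic semigroups are closed and dissipative. -/

section Semigroup

variable {S : ℝ≥0 → X →L[ℝ] X} {G : X →ₗ.[ℝ] X}

/-- For `s ≤ t` the difference is `S s` applied to `S (t - s) f - f`, so continuity at `0` gives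
continuity everywhere. -/
theorem IsSubstochasticSemigroup.norm_sub_le (hS : IsSubstochasticSemigroup S) (f : X)
    (s t : ℝ≥0) : ‖S t f - S s f‖ ≤ ‖S (nndist t s) f - f‖ := by
  wlog h : s ≤ t generalizing s t
  · rw [norm_sub_rev, nndist_comm]
    exact this t s (le_of_not_ge h)
  have hd : s + nndist t s = t := by
    rw [NNReal.nndist_eq, tsub_eq_zero_of_le h, max_eq_left (zero_le), add_tsub_cancel_of_le h]
  conv_lhs => rw [← hd, hS.add, ContinuousLinearMap.comp_apply, ← map_sub]
  exact hS.contraction _ _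

theorem IsSubstochasticSemigroup.continuous_orbit (hS : IsSubstochasticSemigroup S) (f : X) :
    Continuous fun t => S t f := by
  refine continuous_iff_continuousAt.2 fun s => tendsto_iff_norm_sub_tendsto_zero.2 ?_
  have h1 : Tendsto (fun t => nndist t s) (𝓝 s) (𝓝 0) := by
    have : Continuous fun t => nndist t s := by fun_prop
    simpa using this.tendsto s
  have h2 := tendsto_iff_norm_sub_tendsto_zero.1 (hS.strongly_continuous f)
  exact squeeze_zero (fun _ => norm_nonneg _) (fun t => hS.norm_sub_le f s t) (h2.comp h1)

theorem IsGenerator.hasDerivWithinAt (hS : IsSubstochasticSemigroup S) (hG : IsGenerator S G)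
    {f g : X} (hfg : (f, g) ∈ G.graph) {x : ℝ} (hx : 0 ≤ x) :
    HasDerivWithinAt (fun t : ℝ => S t.toNNReal f) (S x.toNNReal g) (Set.Ici x) x := by
  rw [← hasDerivWithinAt_Ioi_iff_Ici, hasDerivWithinAt_iff_tendsto_slope' (by simp)]
  have h1 : Tendsto (fun y : ℝ => (y - x).toNNReal) (𝓝[>] x) (𝓝[>] 0) := by
    refine tendsto_nhdsWithin_iff.2 ⟨?_, ?_⟩
    · have : Continuous fun y : ℝ => (y - x).toNNReal := by fun_prop
      simpa using (this.tendsto x).mono_left nhdsWithin_le_nhds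
    · filter_upwards [self_mem_nhdsWithin] with y hy
      exact Real.toNNReal_pos.2 (sub_pos.2 hy)
  have h2 := ((S x.toNNReal).continuous.tendsto g).comp (((hG f g).1 hfg).comp h1)
  refine h2.congr' ?_
  filter_upwards [self_mem_nhdsWithin] with y hy
  have hxy : 0 ≤ y - x := (sub_pos.2 hy).le
  have hy' : y.toNNReal = x.toNNReal + (y - x).toNNReal := by
    rw [← Real.toNNReal_add hx hxy, add_sub_cancel]
  simp only [Function.comp_apply]
  rw [slope_def_module, hy', hS.add, ContinuousLinearMap.comp_apply, ← map_sub, map_smul,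
    Real.coe_toNNReal _ hxy]

/-- Mean value inequality for `S y f - y • g₀`, whose right derivative is `S y g - g₀`. As `g₀` need
not equal `g`, the bound passes to limits of graph points, which gives closedness of `G`. -/
theorem IsGenerator.norm_sub_sub_le (hS : IsSubstochasticSemigroup S) (hG : IsGenerator S G)
    {f g : X} (hfg : (f, g) ∈ G.graph) (g₀ : X) {t : ℝ≥0} {C : ℝ}
    (hC : ∀ s < t, ‖S s g₀ - g₀‖ ≤ C) :
    ‖S t f - f - (t : ℝ) • g₀‖ ≤ (‖g - g₀‖ + C) * t := by
  have hd (x : ℝ) (hx : x ∈ Set.Ico 0 (t : ℝ)) :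
      HasDerivWithinAt (fun y : ℝ => S y.toNNReal f - y • g₀) (S x.toNNReal g - g₀)
        (Set.Ici x) x := by
    have h := (hasDerivWithinAt_id x (Set.Ici x)).smul_const g₀
    rw [one_smul] at h
    exact (hG.hasDerivWithinAt hS hfg hx.1).sub h
  have hb (x : ℝ) (hx : x ∈ Set.Ico 0 (t : ℝ)) :
      ‖S x.toNNReal g - g₀‖ ≤ ‖g - g₀‖ + C := by
    have h : S x.toNNReal g - g₀ = S x.toNNReal (g - g₀) + (S x.toNNReal g₀ - g₀) := by
      rw [map_sub]; abel
    rw [h]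
    exact (norm_add_le _ _).trans
      (add_le_add (hS.contraction _ _) (hC _ ((Real.toNNReal_lt_iff_lt_coe hx.1).2 hx.2)))
  have hc : ContinuousOn (fun y : ℝ => S y.toNNReal f - y • g₀) (Set.Icc 0 (t : ℝ)) := by
    have h := (hS.continuous_orbit f).comp continuous_real_toNNReal
    exact (h.sub (by fun_prop)).continuousOn
  have := norm_image_sub_le_of_norm_deriv_right_le_segment hc hd hb t ⟨t.2, le_rfl⟩
  simpa [hS.zero, sub_right_comm] using this

theorem IsGenerator.isClosed (hS : IsSubstochasticSemigroup S) (hG : IsGenerator S G) :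
    G.IsClosed := by
  refine isClosed_of_closure_subset fun p hp => ?_
  obtain ⟨f₀, g₀⟩ := p
  refine (hG f₀ g₀).2 (Metric.tendsto_nhds.2 fun ε hε => ?_)
  have h0 := Metric.tendsto_nhds.1 (hS.strongly_continuous g₀) (ε / 2) (by positivity)
  obtain ⟨δ, hδ, hball⟩ := Metric.eventually_nhds_iff.1 h0
  have hlt : ∀ᶠ t : ℝ≥0 in 𝓝[>] 0, dist t 0 < δ :=
    nhdsWithin_le_nhds (Metric.ball_mem_nhds _ hδ)
  filter_upwards [hlt, self_mem_nhdsWithin] with t ht ht0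
  have htpos : (0 : ℝ) < t := NNReal.coe_pos.2 ht0
  have hC (s : ℝ≥0) (hs : s < t) : ‖S s g₀ - g₀‖ ≤ ε / 2 := by
    rw [← dist_eq_norm]
    refine (hball (lt_of_le_of_lt ?_ ht)).le
    simpa [NNReal.dist_eq] using hs.le
  have key : ‖S t f₀ - f₀ - (t : ℝ) • g₀‖ ≤ (‖g₀ - g₀‖ + ε / 2) * t := by
    have hcl : IsClosed {q : X × X |
        ‖S t q.1 - q.1 - (t : ℝ) • g₀‖ ≤ (‖q.2 - g₀‖ + ε / 2) * t} :=
      isClosed_le (by fun_prop) (by fun_prop)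
    exact closure_minimal (fun q hq => hG.norm_sub_sub_le hS hq g₀ hC) hcl hp
  rw [sub_self, norm_zero, zero_add] at key
  have h : (t : ℝ)⁻¹ • (S t f₀ - f₀) - g₀ = (t : ℝ)⁻¹ • (S t f₀ - f₀ - (t : ℝ) • g₀) := by
    rw [smul_sub _ (S t f₀ - f₀), inv_smul_smul₀ htpos.ne']
  rw [dist_eq_norm, h, norm_smul, norm_inv, Real.norm_of_nonneg htpos.le]
  calc (t : ℝ)⁻¹ * ‖S t f₀ - f₀ - (t : ℝ) • g₀‖ ≤ (t : ℝ)⁻¹ * (ε / 2 * t) := by gcongr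
    _ = ε / 2 := by field_simp
    _ < ε := half_lt_self hε

/-- The difference quotient satisfies `f - (S t f - f) / t = (1 + 1/t) f - (1/t) S t f`, of norm at
least `‖f‖` by contractivity. -/
theorem IsGenerator.norm_le_norm_sub (hS : IsSubstochasticSemigroup S) (hG : IsGenerator S G)
    {f g : X} (hfg : (f, g) ∈ G.graph) : ‖f‖ ≤ ‖f - g‖ := by
  have h := (tendsto_const_nhds (x := f)).sub ((hG f g).1 hfg)
  refine ge_of_tendsto h.norm ?_
  filter_upwards [self_mem_nhdsWithin] with t ht0
  have htpos : (0 : ℝ) < t := NNReal.coe_pos.2 ht0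
  have h1 : f - (t : ℝ)⁻¹ • (S t f - f) = (1 + (t : ℝ)⁻¹) • f - (t : ℝ)⁻¹ • S t f := by
    rw [smul_sub, add_smul, one_smul]; abel
  have h2 := norm_sub_norm_le ((1 + (t : ℝ)⁻¹) • f) ((t : ℝ)⁻¹ • S t f)
  rw [← h1, norm_smul, norm_smul, Real.norm_of_nonneg (by positivity),
    Real.norm_of_nonneg (by positivity)] at h2
  have h3 := mul_le_mul_of_nonneg_left (hS.contraction t f) (inv_pos.2 htpos).le
  linarith

end Semigroup

/-- A closed dissipative extension of `T` is the closure of `T` if `1 - T` has dense range. -/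
theorem graph_topologicalClosure_eq_of_dissipative {T G : X →ₗ.[ℝ] X} (hTG : T ≤ G)
    (hG : G.IsClosed) (hdiss : ∀ f g, (f, g) ∈ G.graph → ‖f‖ ≤ ‖f - g‖)
    (hdense : ∀ h : X, h ∈ closure {h | ∃ q ∈ T.graph, q.1 - q.2 = h}) :
    T.graph.topologicalClosure = G.graph := by
  have hle : T.graph ≤ G.graph := LinearPMap.le_graph_of_le hTG
  refine le_antisymm (Submodule.topologicalClosure_minimal _ hle hG) fun p hp => ?_
  obtain ⟨f, g⟩ := p
  refine Metric.mem_closure_iff.2 fun ε hε => ?_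
  obtain ⟨_, ⟨⟨u, v⟩, hq, rfl⟩, hlt⟩ :=
    Metric.mem_closure_iff.1 (hdense (f - g)) (ε / 2) (by positivity)
  refine ⟨(u, v), hq, ?_⟩
  rw [dist_eq_norm] at hlt
  -- Dissipativity of `G` at the difference bounds `f - u`, and then `g - v`, by the error in the
  -- range of `1 - T`.
  have h1 := hdiss _ _ (G.graph.sub_mem hp (hle hq))
  have h2 : f - u - (g - v) = f - g - (u - v) := by abel
  have h3 : ‖g - v‖ ≤ ‖f - u‖ + ‖f - u - (g - v)‖ := by
    simpa using norm_sub_le (f - u) (f - u - (g - v))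
  simp only at h1
  rw [h2] at h1 h3
  rw [Prod.dist_eq, dist_eq_norm, dist_eq_norm, max_lt_iff]
  constructor <;> simp only <;> linarith

/-! ### A priori estimates for the decay operator. -/

section Decay

variable {r d a : ℕ+ → ℝ}

theorem mem_graph_decaySum {u v : X} :
    (u, v) ∈ (decaySum r d a).graph ↔ u ∈ multDomain (theta r d a) ∧ u ∈ multDomain r ∧
      ∀ n, v n = -(theta r d a n * u n) + r (n + 1) * u (n + 1) := by
  rw [LinearPMap.mem_graph_iff]
  constructor
  · rintro ⟨⟨y, hy⟩, rfl, rfl⟩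
    exact ⟨hy.1, hy.2, fun n => rfl⟩
  · rintro ⟨h1, h2, h3⟩
    exact ⟨⟨u, h1, h2⟩, rfl, X.ext fun n => (h3 n).symm⟩

/-- The weight that is left over when the mass gained by decay is deducted from the loss. -/
def lossWeight (r d a : ℕ+ → ℝ) (n : ℕ+) : ℝ := n * a n + n * d n + r n

/-- The index `1` missed by the shift carries the factor `0`; no summability is required. -/
theorem pnat_tsum_succ_mul {F : ℕ+ → ℝ} :
    ∑' n : ℕ+, (n : ℝ) * F (n + 1) = ∑' n : ℕ+, ((n : ℝ) - 1) * F n := by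
  have hinj : Function.Injective fun n : ℕ+ => n + 1 := add_left_injective 1
  rw [← hinj.tsum_eq (f := fun n : ℕ+ => ((n : ℝ) - 1) * F n)]
  · refine tsum_congr fun n => ?_
    push_cast
    ring
  · intro n hn
    have hn1 : n ≠ 1 := by
      rintro rfl
      simp at hn
    obtain ⟨m, rfl⟩ := PNat.exists_eq_succ_of_ne_one hn1
    exact ⟨m, rfl⟩

/-- The reverse triangle inequality in each entry leaves loss minus gain; shifting the index turns
the gain into `∑ (n - 1) r_n |u_n|`. -/
theorem norm_add_sum_le_of_mem_graph (hr : ∀ n, 0 < r n) (hd : ∀ n, 0 ≤ d n) (ha : ∀ n, 0 ≤ a n)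
    {u v : X} (h : (u, v) ∈ (decaySum r d a).graph) (s : Finset ℕ+) :
    ‖u‖ + ∑ n ∈ s, lossWeight r d a n * |u n| ≤ ‖u - v‖ := by
  obtain ⟨hθ, hru, hv⟩ := mem_graph_decaySum.1 h
  have hw0 (n : ℕ+) : 0 ≤ lossWeight r d a n := by
    have := hr n; have := hd n; have := ha n
    unfold lossWeight; positivity
  have hθ0 (n : ℕ+) : 0 ≤ theta r d a n := by
    have := hr n; have := hd n; have := ha n
    unfold theta; positivity
  have s1 : Summable fun n : ℕ+ => (n : ℝ) * (theta r d a n * |u n|) := by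
    refine Summable.congr hθ fun n => ?_
    rw [abs_mul, abs_of_nonneg (hθ0 n)]
  have s2 : Summable fun n : ℕ+ => (n : ℝ) * (r (n + 1) * |u (n + 1)|) := by
    refine Summable.congr (shift_mult_mem hru) fun n => ?_
    rw [abs_mul, abs_of_nonneg (hr _).le]
  have s3 : Summable fun n : ℕ+ => ((n : ℝ) - 1) * (r n * |u n|) := by
    have hn (n : ℕ+) : (1 : ℝ) ≤ n := by exact_mod_cast one_le (a := n)
    refine Summable.of_nonneg_of_le (fun n => ?_) (fun n => ?_) hru
    · exact mul_nonneg (sub_nonneg.2 (hn n)) (mul_nonneg (hr n).le (abs_nonneg _))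
    · rw [abs_mul, abs_of_nonneg (hr n).le]
      exact mul_le_mul_of_nonneg_right (by linarith) (mul_nonneg (hr n).le (abs_nonneg _))
  have hsplit (n : ℕ+) : (n : ℝ) * (theta r d a n * |u n|) - ((n : ℝ) - 1) * (r n * |u n|) =
      lossWeight r d a n * |u n| := by
    unfold theta lossWeight; ring
  have s4 : Summable fun n => lossWeight r d a n * |u n| := (s1.sub s3).congr hsplit
  have e4 : ∑' n, lossWeight r d a n * |u n| = ∑' n : ℕ+, (n : ℝ) * (theta r d a n * |u n|) -
      ∑' n : ℕ+, (n : ℝ) * (r (n + 1) * |u (n + 1)|) := by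
    rw [pnat_tsum_succ_mul (F := fun n => r n * |u n|), ← s1.tsum_sub s3]
    exact (tsum_congr hsplit).symm
  have hs := s4.sum_le_tsum s fun n _ => mul_nonneg (hw0 n) (abs_nonneg _)
  have hmain : ‖u‖ + (∑' n : ℕ+, (n : ℝ) * (theta r d a n * |u n|) -
      ∑' n : ℕ+, (n : ℝ) * (r (n + 1) * |u (n + 1)|)) ≤ ‖u - v‖ := by
    rw [X.norm_def, X.norm_def, ← s1.tsum_sub s2, ← u.summable.tsum_add (s1.sub s2)]
    refine (u.summable.add (s1.sub s2)).tsum_le_tsum (fun n => ?_) (u - v).summable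
    rw [← mul_sub, ← mul_add]
    refine mul_le_mul_of_nonneg_left ?_ (by positivity)
    have e : (u - v) n = (1 + theta r d a n) * u n - r (n + 1) * u (n + 1) := by
      rw [X.sub_apply, hv]; ring
    rw [e]
    refine le_trans (le_of_eq ?_) (abs_sub_abs_le_abs_sub _ _)
    rw [abs_mul, abs_mul, abs_of_nonneg (hr _).le, abs_of_nonneg (add_nonneg zero_le_one (hθ0 n))]
    ring
  linarith

/-- With `n = i + 1`, each summand equals `n r_{n+1} u_{n+1} - (n - 1) r_n u_n`, so the sum
telescopes. -/
theorem mul_succ_eq_sum {u v : X}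
    (hv : ∀ n, v n = -(theta r d a n * u n) + r (n + 1) * u (n + 1)) (N : ℕ) :
    (N : ℝ) * (r N.succPNat * u N.succPNat) = ∑ i ∈ Finset.range N,
      ((i.succPNat : ℝ) * v i.succPNat + lossWeight r d a i.succPNat * u i.succPNat) := by
  induction N with
  | zero => simp
  | succ N ih =>
    have e : N.succPNat + 1 = (N + 1).succPNat := rfl
    have c : (N.succPNat : ℝ) = N + 1 := by simp
    rw [Finset.sum_range_succ, ← ih, hv, e, theta, lossWeight, c]
    push_cast
    ring

theorem mul_mul_abs_le_of_mem_graph (hr : ∀ n, 0 < r n) (hd : ∀ n, 0 ≤ d n) (ha : ∀ n, 0 ≤ a n)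
    {u v : X} (h : (u, v) ∈ (decaySum r d a).graph) (n : ℕ+) :
    (n : ℝ) * r n * |u n| ≤ ‖v‖ + 2 * ‖u - v‖ := by
  have hw0 (n : ℕ+) : 0 ≤ lossWeight r d a n := by
    have := hr n; have := hd n; have := ha n
    unfold lossWeight; positivity
  have hw (s : Finset ℕ+) : ∑ n ∈ s, lossWeight r d a n * |u n| ≤ ‖u - v‖ := by
    linarith [norm_add_sum_le_of_mem_graph hr hd ha h s, norm_nonneg u]
  obtain ⟨N, rfl⟩ : ∃ N : ℕ, n = N.succPNat := ⟨n.natPred, (PNat.succPNat_natPred n).symm⟩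
  -- The telescoped identity carries the factor `N` instead of `N + 1`; this supplies the missing
  -- unit and the second `‖u - v‖`.
  have h1 : r N.succPNat * |u N.succPNat| ≤ ‖u - v‖ := by
    refine le_trans (mul_le_mul_of_nonneg_right ?_ (abs_nonneg _))
      ((Finset.sum_singleton _ _).symm.le.trans (hw {N.succPNat}))
    have := hd N.succPNat; have := ha N.succPNat
    exact le_add_of_nonneg_left (by positivity)
  let e : ℕ ↪ ℕ+ := ⟨Nat.succPNat, Nat.succPNat_injective⟩
  have h2 : (N : ℝ) * (r N.succPNat * |u N.succPNat|) ≤ ‖v‖ + ‖u - v‖ := by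
    have hN : (N : ℝ) * (r N.succPNat * |u N.succPNat|) =
        |(N : ℝ) * (r N.succPNat * u N.succPNat)| := by
      rw [abs_mul, abs_mul, abs_of_nonneg (hr _).le, Nat.abs_cast]
    rw [hN, mul_succ_eq_sum (mem_graph_decaySum.1 h).2.2]
    calc _ ≤ ∑ i ∈ Finset.range N, ((i.succPNat : ℝ) * |v i.succPNat| +
          lossWeight r d a i.succPNat * |u i.succPNat|) := by
          refine (Finset.abs_sum_le_sum_abs _ _).trans (Finset.sum_le_sum fun i _ => ?_)
          refine (abs_add_le _ _).trans (le_of_eq ?_)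
          rw [abs_mul, abs_mul, abs_of_nonneg (hw0 _), Nat.abs_cast]
      _ = ∑ n ∈ (Finset.range N).map e, (n : ℝ) * |v n| +
          ∑ n ∈ (Finset.range N).map e, lossWeight r d a n * |u n| := by
          rw [Finset.sum_map, Finset.sum_map, ← Finset.sum_add_distrib]
          rfl
      _ ≤ ‖v‖ + ‖u - v‖ :=
          add_le_add (v.summable.sum_le_tsum _ fun _ _ => by positivity) (hw _)
  have c : (N.succPNat : ℝ) = N + 1 := by simp
  rw [c]
  linarith

/-! ### Dense range, closability and identification of `K`. -/

theorem single_mem_multDomain (w : ℕ+ → ℝ) (n : ℕ+) : X.single n ∈ multDomain w :=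
  summable_of_ne_finset_zero (s := {n}) fun m hm => by
    change (m : ℝ) * |w m * X.single n m| = 0
    rw [X.single_of_ne (show m ≠ n by simpa using hm), mul_zero, abs_zero, mul_zero]

/-- The range of `1 - T`. -/
def rangeOneSub (T : X →ₗ.[ℝ] X) : Submodule ℝ X :=
  T.graph.map (LinearMap.fst ℝ X X - LinearMap.snd ℝ X X)

/-- Back substitution: `(1 - T) e_1 = (1 + θ_1) e_1` and `(1 - T) e_{n+1} = (1 + θ_{n+1}) e_{n+1} -
r_{n+1} e_n`. -/
theorem single_mem_rangeOneSub (hr : ∀ n, 0 < r n) (hd : ∀ n, 0 ≤ d n) (ha : ∀ n, 0 ≤ a n)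
    (n : ℕ+) : X.single n ∈ rangeOneSub (decaySum r d a) := by
  have hpos (n : ℕ+) : 1 + theta r d a n ≠ 0 := by
    have := hr n; have := hd n; have := ha n
    unfold theta; positivity
  induction n using PNat.recOn with
  | one =>
    have hg : (X.single 1, -(theta r d a 1) • X.single 1) ∈ (decaySum r d a).graph := by
      refine mem_graph_decaySum.2
        ⟨single_mem_multDomain _ _, single_mem_multDomain _ _, fun m => ?_⟩
      have hm : m + 1 ≠ 1 := (PNat.lt_add_left 1 m).ne'
      rw [X.single_of_ne hm, X.smul_apply]
      by_cases h : m = 1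
      · subst h; ring
      · rw [X.single_of_ne h]; ring
    have hR := (rangeOneSub (decaySum r d a)).smul_mem (1 + theta r d a 1)⁻¹
      (Submodule.mem_map_of_mem hg)
    convert! hR using 1
    refine (inv_smul_smul₀ (hpos 1) (X.single 1)).symm.trans ?_
    congr 1
    simp [add_smul]
  | succ n ih =>
    have hg : (X.single (n + 1), -(theta r d a (n + 1)) • X.single (n + 1) +
        r (n + 1) • X.single n) ∈ (decaySum r d a).graph := by
      refine mem_graph_decaySum.2
        ⟨single_mem_multDomain _ _, single_mem_multDomain _ _, fun m => ?_⟩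
      rw [X.add_apply, X.smul_apply, X.smul_apply]
      by_cases h : m = n
      · subst h
        have hm : m ≠ m + 1 := (PNat.lt_add_right m 1).ne
        rw [X.single_of_ne hm, X.single_same, X.single_same]; ring
      · rw [X.single_of_ne h, X.single_of_ne (m := m + 1) (fun e => h (add_right_cancel e))]
        by_cases h' : m = n + 1
        · subst h'; ring
        · rw [X.single_of_ne h']; ring
    have hR := (rangeOneSub (decaySum r d a)).smul_mem (1 + theta r d a (n + 1))⁻¹
      (add_mem (Submodule.mem_map_of_mem hg) (Submodule.smul_mem _ (r (n + 1)) ih))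
    convert! hR using 1
    refine (inv_smul_smul₀ (hpos (n + 1)) (X.single (n + 1))).symm.trans ?_
    congr 1
    simp only [add_smul, one_smul, neg_smul, LinearMap.sub_apply, LinearMap.fst_apply,
      LinearMap.snd_apply]
    abel

theorem decaySum_dense_range (hr : ∀ n, 0 < r n) (hd : ∀ n, 0 ≤ d n) (ha : ∀ n, 0 ≤ a n)
    (h : X) : h ∈ closure {h | ∃ q ∈ (decaySum r d a).graph, q.1 - q.2 = h} := by
  have := X.topologicalClosure_eq_top_of_single_mem (single_mem_rangeOneSub hr hd ha)
  exact (this ▸ Submodule.mem_top : h ∈ (rangeOneSub (decaySum r d a)).topologicalClosure)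

/-- The entrywise formula for `T` is a closed relation on `X × X`, and it forces `v = 0` when `u =
0`. -/
theorem decaySum_isClosable : (decaySum r d a).IsClosable := by
  refine ⟨(decaySum r d a).graph.topologicalClosure.toLinearPMap,
    (Submodule.toLinearPMap_graph_eq _ fun p hp hp0 => ?_).symm⟩
  have hcl : IsClosed {q : X × X | ∀ n,
      q.2 n = -(theta r d a n * q.1 n) + r (n + 1) * q.1 (n + 1)} := by
    simp only [Set.ofPred_forall]
    refine isClosed_iInter fun n => isClosed_eq ?_ ?_
    · exact (X.continuous_apply n).comp continuous_snd
    · exact ((((X.continuous_apply n).comp continuous_fst).const_mul _).neg).add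
        (((X.continuous_apply (n + 1)).comp continuous_fst).const_mul _)
  have h := closure_minimal (fun q hq => (mem_graph_decaySum.1 hq).2.2) hcl hp
  refine X.ext fun n => (h n).trans ?_
  rw [hp0]
  change -(theta r d a n * 0) + r (n + 1) * 0 = 0
  ring

theorem graph_K : (K r d a).graph = (decaySum r d a).graph.topologicalClosure :=
  decaySum_isClosable.graph_closure_eq_closure_graph.symm

theorem eq_K_of_generatesExtension (hr : ∀ n, 0 < r n) (hd : ∀ n, 0 ≤ d n) (ha : ∀ n, 0 ≤ a n)
    {S : ℝ≥0 → X →L[ℝ] X} {G : X →ₗ.[ℝ] X} (h : GeneratesExtension (decaySum r d a) S G) :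
    G = K r d a := by
  obtain ⟨hS, hG, hle⟩ := h
  refine LinearPMap.eq_of_eq_graph ?_
  rw [graph_K]
  exact (graph_topologicalClosure_eq_of_dissipative hle (hG.isClosed hS)
    (fun f g hfg => hG.norm_le_norm_sub hS hfg) (decaySum_dense_range hr hd ha)).symm

/-! ### Summability and decay on the domain of `K`. -/

theorem summable_lossWeight_mul_abs (hr : ∀ n, 0 < r n) (hd : ∀ n, 0 ≤ d n) (ha : ∀ n, 0 ≤ a n)
    {f : X} (hf : f ∈ (K r d a).domain) : Summable fun n => lossWeight r d a n * |f n| := by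
  obtain ⟨g, hg⟩ := LinearPMap.mem_domain_iff.1 hf
  rw [graph_K] at hg
  refine summable_of_sum_le (c := ‖f - g‖) (fun n => ?_) fun s => ?_
  · have := hr n; have := hd n; have := ha n
    unfold lossWeight; positivity
  · have hcl : IsClosed {q : X × X | ∑ n ∈ s, lossWeight r d a n * |q.1 n| ≤ ‖q.1 - q.2‖} := by
      refine isClosed_le (continuous_finsetSum _ fun n _ => ?_) (by fun_prop)
      exact ((X.continuous_apply n).comp continuous_fst).abs.const_mul _
    refine closure_minimal (fun q hq => ?_) hcl hg
    have := norm_add_sum_le_of_mem_graph hr hd ha hq s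
    simp only [Set.mem_ofPred_eq]
    linarith [norm_nonneg q.1]

theorem tendsto_mul_mul_of_mem_domain (hr : ∀ n, 0 < r n) (hd : ∀ n, 0 ≤ d n)
    (ha : ∀ n, 0 ≤ a n) {f : X} (hf : f ∈ (K r d a).domain) :
    Tendsto (fun n : ℕ+ => (n : ℝ) * r n * f n) atTop (𝓝 0) := by
  obtain ⟨g, hg⟩ := LinearPMap.mem_domain_iff.1 hf
  rw [graph_K] at hg
  have hbd (n : ℕ+) {p : X × X} (hp : p ∈ (decaySum r d a).graph.topologicalClosure) :
      (n : ℝ) * r n * |p.1 n| ≤ ‖p.2‖ + 2 * ‖p.1 - p.2‖ := by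
    have hcl : IsClosed {q : X × X | (n : ℝ) * r n * |q.1 n| ≤ ‖q.2‖ + 2 * ‖q.1 - q.2‖} :=
      isClosed_le (((X.continuous_apply n).comp continuous_fst).abs.const_mul _) (by fun_prop)
    exact closure_minimal (fun q hq => mul_mul_abs_le_of_mem_graph hr hd ha hq n) hcl hp
  refine Metric.tendsto_nhds.2 fun ε hε => ?_
  -- The bound `‖g - v‖ + 2 (‖f - u‖ + ‖g - v‖)` stays below `5 ε / 10`, leaving `ε / 2` for `n r_n
  -- |u_n|`.
  obtain ⟨⟨u, v⟩, hq, hlt⟩ := Metric.mem_closure_iff.1 hg (ε / 10) (by positivity)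
  rw [Prod.dist_eq, dist_eq_norm, dist_eq_norm, max_lt_iff] at hlt
  simp only at hlt
  have hu : Tendsto (fun n : ℕ+ => (n : ℝ) * |r n * u n|) atTop (𝓝 0) :=
    (Summable.tendsto_cofinite_zero (mem_graph_decaySum.1 hq).2.1).mono_left atTop_le_cofinite
  filter_upwards [hu.eventually_lt_const (half_pos hε)] with n hn
  have h1 := hbd n (sub_mem hg ((decaySum r d a).graph.le_topologicalClosure hq))
  simp only [Prod.fst_sub, Prod.snd_sub] at h1
  have h2 := norm_sub_le (f - u) (g - v)
  have h0 : 0 ≤ (n : ℝ) * r n := mul_nonneg (by positivity) (hr n).le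
  have h3 : |f n| ≤ |(f - u) n| + |u n| := by
    simpa [X.sub_apply] using abs_add_le ((f - u) n) (u n)
  have h4 := mul_le_mul_of_nonneg_left h3 h0
  rw [abs_mul, abs_of_nonneg (hr n).le, ← mul_assoc] at hn
  rw [Real.dist_eq, sub_zero, abs_mul, abs_of_nonneg h0]
  linarith

end Decay

end DecayFragmentation

theorem mainTheorem8 (r d a : ℕ+ → ℝ)
    (hr : ∀ n, 0 < r n) (hd : ∀ n, 0 ≤ d n) (ha₁ : a 1 = 0) (ha : ∀ n, 2 ≤ n → 0 < a n) :
    (DecayFragmentation.decaySum r d a).IsClosable ∧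
    (∀ G, DecayFragmentation.IsSmallestGenerator (DecayFragmentation.decaySum r d a) G →
      G = DecayFragmentation.K r d a) ∧
    ∀ f ∈ (DecayFragmentation.K r d a).domain, f.Nonneg →
      (Summable fun n : ℕ+ => (n : ℝ) * a n * f n) ∧
      (Summable fun n : ℕ+ => (n : ℝ) * d n * f n) ∧
      (Summable fun n : ℕ+ => r n * f n) ∧
      Tendsto (fun n : ℕ+ => (n : ℝ) * r n * f n) atTop (𝓝 0) := by
  have ha0 (n : ℕ+) : 0 ≤ a n := by
    by_cases h : n = 1
    · rw [h, ha₁]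
    · refine (ha n ?_).le
      obtain ⟨m, rfl⟩ := PNat.exists_eq_succ_of_ne_one h
      exact add_le_add_left one_le 1
  refine ⟨DecayFragmentation.decaySum_isClosable, fun G hG => ?_, fun f hf hpos => ?_⟩
  · obtain ⟨S, hS, -⟩ := hG
    exact DecayFragmentation.eq_K_of_generatesExtension hr hd ha0 hS
  · have hs := DecayFragmentation.summable_lossWeight_mul_abs hr hd ha0 hf
    have hterm {w : ℕ+ → ℝ} (h0 : ∀ n, 0 ≤ w n)
        (h1 : ∀ n, w n ≤ DecayFragmentation.lossWeight r d a n) :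
        Summable fun n => w n * f n := by
      refine Summable.of_nonneg_of_le (fun n => mul_nonneg (h0 n) (hpos n)) (fun n => ?_) hs
      rw [abs_of_nonneg (hpos n)]
      exact mul_le_mul_of_nonneg_right (h1 n) (hpos n)
    have na (n : ℕ+) : 0 ≤ (n : ℝ) * a n := mul_nonneg (by positivity) (ha0 n)
    have nd (n : ℕ+) : 0 ≤ (n : ℝ) * d n := mul_nonneg (by positivity) (hd n)
    refine ⟨hterm na fun n => ?_, hterm nd fun n => ?_, hterm (fun n => (hr n).le) fun n => ?_,
      DecayFragmentation.tendsto_mul_mul_of_mem_domain hr hd ha0 hf⟩ <;>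
    · unfold DecayFragmentation.lossWeight
      linarith [na n, nd n, hr n]
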